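/- Fix a positive integer $m$. For a real $m\times m$ matrix $A$ let $\lfloor A\rfloor$ be its strictly lower triangular part, $\mathbb{D}(A)$ its diagonal part, and $A_{1/2}=\lfloor A\rfloor+\tfrac12\mathbb{D}(A)$. Let $\mathcal{L}$ be the space of real lower triangular $m\times m$ matrices and $\mathcal{L}_+\subset\mathcal{L}$ the open set of those with positive diagonal entries, with tangent spaces identified with $\mathcal{L}$ and with the Riemannian metric $$\tilde g_L(X,Y)=\langle\lfloor X\rfloor,\lfloor Y\rfloor\rangle_F+\langle\mathbb{D}(L)^{-1}\mathbb{D}(X),\mathbb{D}(L)^{-1}\mathbb{D}(Y)\rangle_F ,$$ where $\langle A,B\rangle_F=\sum_{i,j}A_{ij}B_{ij}$. Let $\mathcal{S}_m^+$ be the symmetric positive definite matrices, an open subset of the space $\mathcal{S}_m$ of symmetric matrices, with tangent spaces identified with $\mathcal{S}_m$. For $P\in\mathcal{S}_m^+$ let $\mathscr{L}(P)$ be its Cholesky factor, i.e. the unique $L\in\mathcal{L}_+$ with $LL^\top=P$, and equip $\mathcal{S}_m^+$ with the Riemannian (Log-Cholesky) metric $$g_P(W,V)=\tilde g_L\bigl(L(L^{-1}WL^{-\top})_{1/2},\,L(L^{-1}VL^{-\top})_{1/2}\bigr),\qquad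 L=\mathscr{L}(P).$$ Then $(\mathcal{L}_+,\tilde g)$ and $(\mathcal{S}_m^+,g)$ are smooth Riemannian manifolds, any two points of either are joined by a geodesic, and parallel transport for the Levi-Civita connection along geodesics is as follows. (i) For $L,K\in\mathcal{L}_+$ and every geodesic of $(\mathcal{L}_+,\tilde g)$ from $L$ to $K$, parallel transport along it sends each $X\in T_L\mathcal{L}_+=\mathcal{L}$ to $$\lfloor X\rfloor+\mathbb{D}(K)\,\mathbb{D}(L)^{-1}\,\mathbb{D}(X)\in T_K\mathcal{L}_+ .$$ (ii) For $P,Q\in\mathcal{S}_m^+$ and every geodesic of $(\mathcal{S}_m^+,g)$ from $P$ to $Q$, parallel transport $\tau_{P,Q}$ along it sends each $W\in T_P\mathcal{S}_m^+=\mathcal{S}_m$ to $$\tau_{P,Q}(W)=KY^\top+YK^\top,\qquad Y=\lfloor X\rfloor+\mathbb{D}(K)\,\mathbb{D}(L)^{-1}\,\mathbb{D}(X),$$ where $L=\mathscr{L}(P)$, $K=\mathscr{L}(Q)$ and $X=L(L^{-1}WL^{-\top})_{1/2}$. -/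

import Mathlib

open Set
open scoped ContDiff Matrix

attribute [local instance] Matrix.frobeniusNormedAddCommGroup Matrix.frobeniusNormedSpace

namespace LogCholesky

noncomputable section

/-! ### Riemannian geometry of an open subset of a normed space

A manifold `U` that is an open subset of a finite-dimensional vector space `E` has the tangent
space `E` at each point, and the inclusion is a global chart. A metric on `U` is a function
`g : E → E → E → ℝ`, where `g p v w` is the inner product of `v` and `w` at `p`; its values at
points outside `U` play no role. -/

section Riemannian

variable {E : Type*} [NormedAddCommGroup E] [NormedSpace ℝ E]

/-- `g` is a smooth Riemannian metric on the open set `U`. -/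
structure IsRiemannianMetricOn (U : Set E) (g : E → E → E → ℝ) : Prop where
  isOpen : IsOpen U
  add_left : ∀ p ∈ U, ∀ u v w, g p (u + v) w = g p u w + g p v w
  smul_left : ∀ p ∈ U, ∀ (c : ℝ) (v w : E), g p (c • v) w = c * g p v w
  symm : ∀ p ∈ U, ∀ v w, g p v w = g p w v
  pos : ∀ p ∈ U, ∀ v, v ≠ 0 → 0 < g p v v
  smooth : ∀ v w, ContDiffOn ℝ ∞ (fun p => g p v w) U

/-- The Christoffel symbol of the first kind of the Levi-Civita connection of `g`: this is
`g_p(Γ_p(u, v), w)`, that is, half of `(∂_u g)(v, w) + (∂_v g)(u, w) - (∂_w g)(u, v)` at `p`. -/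
def christoffelFirst (g : E → E → E → ℝ) (p u v w : E) : ℝ :=
  (1 / 2) * (fderiv ℝ (fun q => g q v w) p u + fderiv ℝ (fun q => g q u w) p v
    - fderiv ℝ (fun q => g q u v) p w)

/-- The velocity of a curve on `[0, 1]` (one-sided at the end points). -/
def velocity (γ : ℝ → E) (t : ℝ) : E := derivWithin γ (Icc 0 1) t

/-- `A` is the Levi-Civita covariant derivative at time `t` of the vector field `V` along the
curve `γ`: `A = V' + Γ(γ', V)`, with the index lowered by the (nondegenerate) metric. -/
def IsCovDerivAlong (g : E → E → E → ℝ) (γ V : ℝ → E) (t : ℝ) (A : E) : Prop :=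
  ∀ w, g (γ t) A w =
    g (γ t) (velocity V t) w + christoffelFirst g (γ t) (velocity γ t) (V t) w

/-- `V` is a smooth parallel vector field along the curve `γ` on `[0, 1]`. -/
structure IsParallelAlong (g : E → E → E → ℝ) (γ V : ℝ → E) : Prop where
  smooth : ContDiffOn ℝ ∞ V (Icc 0 1)
  covDeriv_eq_zero : ∀ t ∈ Icc (0 : ℝ) 1, IsCovDerivAlong g γ V t 0

/-- `γ` is a geodesic of `(U, g)` on `[0, 1]` with `γ 0 = p` and `γ 1 = q`. -/
structure IsGeodesic (U : Set E) (g : E → E → E → ℝ) (p q : E) (γ : ℝ → E) : Prop where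
  smooth : ContDiffOn ℝ ∞ γ (Icc 0 1)
  mem : ∀ t ∈ Icc (0 : ℝ) 1, γ t ∈ U
  source : γ 0 = p
  target : γ 1 = q
  velocity_parallel : IsParallelAlong g γ (velocity γ)

/-- Parallel transport along the curve `γ` on `[0, 1]` sends the tangent vector `v` at `γ 0` to
the tangent vector `w` at `γ 1`. -/
def Transports (g : E → E → E → ℝ) (γ : ℝ → E) (v w : E) : Prop :=
  ∃ V : ℝ → E, IsParallelAlong g γ V ∧ V 0 = v ∧ V 1 = w

end Riemannian

/-! ### Lower triangular, symmetric and symmetric positive definite matrices -/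

variable {m : ℕ}

/-- The strictly lower triangular part `⌊A⌋`. -/
def lowPart (A : Matrix (Fin m) (Fin m) ℝ) : Matrix (Fin m) (Fin m) ℝ :=
  Matrix.of fun i j => if j < i then A i j else 0

/-- The diagonal part `𝔻(A)`. -/
def diagPart (A : Matrix (Fin m) (Fin m) ℝ) : Matrix (Fin m) (Fin m) ℝ :=
  Matrix.diagonal fun i => A i i

/-- `S_{1/2}`: the lower triangular part of `S` with the diagonal entries halved. -/
def halfLower (S : Matrix (Fin m) (Fin m) ℝ) : Matrix (Fin m) (Fin m) ℝ :=
  lowPart S + (1 / 2 : ℝ) • diagPart S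

/-- The Frobenius inner product. -/
def frobInner (A B : Matrix (Fin m) (Fin m) ℝ) : ℝ := ∑ i, ∑ j, A i j * B i j

/-- The vector space `𝓛` of lower triangular matrices. -/
def lowerTri (m : ℕ) : Submodule ℝ (Matrix (Fin m) (Fin m) ℝ) where
  carrier := {A | ∀ i j, i < j → A i j = 0}
  zero_mem' := fun _ _ _ => rfl
  add_mem' := fun {A B} hA hB i j hij => by simp [hA i j hij, hB i j hij]
  smul_mem' := fun c A hA i j hij => by simp [hA i j hij]

/-- The vector space of symmetric matrices. -/
def symMat (m : ℕ) : Submodule ℝ (Matrix (Fin m) (Fin m) ℝ) where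
  carrier := {A | A.IsSymm}
  zero_mem' := Matrix.isSymm_zero
  add_mem' := fun hA hB => Matrix.IsSymm.add hA hB
  smul_mem' := fun c _ hA => Matrix.IsSymm.smul hA c

/-- The Cholesky space `𝓛₊`: lower triangular matrices with positive diagonal. -/
def choleskySpace (m : ℕ) : Set (lowerTri m) :=
  {L | ∀ i, 0 < (L : Matrix (Fin m) (Fin m) ℝ) i i}

/-- The symmetric positive definite matrices. -/
def spd (m : ℕ) : Set (symMat m) :=
  {P | (P : Matrix (Fin m) (Fin m) ℝ).PosDef}

open Classical in
/-- The Cholesky factor of `P`: the lower triangular `L` with positive diagonal such that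
`P = L Lᵀ` (and `0` if there is none). -/
def cholesky (P : symMat m) : lowerTri m :=
  if h : ∃ L ∈ choleskySpace m,
      (L : Matrix (Fin m) (Fin m) ℝ) * (L : Matrix (Fin m) (Fin m) ℝ)ᵀ = P
  then h.choose else 0

theorem mul_halfLower_mem (L : lowerTri m) (S : Matrix (Fin m) (Fin m) ℝ) :
    (L : Matrix (Fin m) (Fin m) ℝ) * halfLower S ∈ lowerTri m := by
  intro i j hij
  rw [Matrix.mul_apply]
  refine Finset.sum_eq_zero fun k _ => ?_
  rcases lt_or_ge i k with h | h
  · rw [L.2 i k h, zero_mul]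
  · have hk : k < j := lt_of_le_of_lt h hij
    simp [halfLower, lowPart, diagPart, hk.ne, not_lt.2 hk.le]

/-- The lower triangular matrix `L (L⁻¹ W L⁻ᵀ)_{1/2}`. -/
def pullVec (L : lowerTri m) (W : Matrix (Fin m) (Fin m) ℝ) : lowerTri m :=
  ⟨(L : Matrix (Fin m) (Fin m) ℝ) *
    halfLower ((L : Matrix (Fin m) (Fin m) ℝ)⁻¹ * W * ((L : Matrix (Fin m) (Fin m) ℝ)⁻¹)ᵀ),
    mul_halfLower_mem L _⟩

/-- The metric `g̃` on `𝓛₊`. -/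
def cholMetric (L X Y : lowerTri m) : ℝ :=
  frobInner (lowPart (X : Matrix (Fin m) (Fin m) ℝ)) (lowPart Y) +
    frobInner ((diagPart (L : Matrix (Fin m) (Fin m) ℝ))⁻¹ * diagPart X)
      ((diagPart (L : Matrix (Fin m) (Fin m) ℝ))⁻¹ * diagPart Y)

/-- The Log-Cholesky metric `g` on the symmetric positive definite matrices. -/
def logCholMetric (P W V : symMat m) : ℝ :=
  cholMetric (cholesky P) (pullVec (cholesky P) W) (pullVec (cholesky P) V)

/-- The matrix `⌊X⌋ + 𝔻(K) 𝔻(L)⁻¹ 𝔻(X)`. -/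
def transportFormula (L K X : Matrix (Fin m) (Fin m) ℝ) : Matrix (Fin m) (Fin m) ℝ :=
  lowPart X + diagPart K * (diagPart L)⁻¹ * diagPart X

end

end LogCholesky

open LogCholesky

/-! Both metrics are Euclidean metrics in disguise. On `choleskySpace m` the strictly lower entries
carry the flat metric and each diagonal entry carries `dx²/x²` on the positive half-line, so taking
logarithms on the diagonal is an isometry `φ` onto all lower triangular matrices with the Frobenius
product. In such a chart the Christoffel symbols reduce to the second derivative of `φ`
(`christoffelFirst_eq`), so a field `V` is parallel exactly when `dφ(V)` is constant. Preimages of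
segments are geodesics, and transport depends only on the end points: `Y` is the image of `X` iff
`dφ_K Y = dφ_L X` (`transports_iff`). As `dφ_L` divides each diagonal entry by `L i i`, solving for
`Y` gives the formula.

The map `S(L) = L Lᵀ` is a bijection from `choleskySpace m` onto `spd m`, and its differential `X ↦
L Xᵀ + X Lᵀ` has inverse `W ↦ L (L⁻¹ W L⁻ᵀ)_{1/2}`. Thus the Log-Cholesky metric is the pullback of
`cholMetric` by the Cholesky map, which is smooth by the inverse function theorem. The flat chart
transfers (`IsFlatChart.transfer`), and the second formula is the first one conjugated by `dS`. -/

namespace LogCholesky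

/-! ### Flat metrics

A metric which is the pullback of a constant inner product by a global diffeomorphism onto a vector
space: a vector field is parallel if and only if its image under the differential is constant. -/

section Flat

variable {E F : Type*} [NormedAddCommGroup E] [NormedSpace ℝ E]
  [NormedAddCommGroup F] [NormedSpace ℝ F]

/-- `φ` is a diffeomorphism from the open set `U` onto `F` with inverse `ψ`, and `g` is the
pullback by `φ` of the constant inner product `B`. -/
structure IsFlatChart (U : Set E) (g : E → E → E → ℝ) (φ : E → F) (ψ : F → E)
    (B : F →L[ℝ] F →L[ℝ] ℝ) : Prop where
  isOpen : IsOpen U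
  smooth : ContDiffOn ℝ ∞ φ U
  smooth_inv : ContDiff ℝ ∞ ψ
  mem : ∀ y, ψ y ∈ U
  right_inv : ∀ y, φ (ψ y) = y
  left_inv : ∀ x ∈ U, ψ (φ x) = x
  symm : ∀ v w, B v w = B w v
  pos : ∀ v, v ≠ 0 → 0 < B v v
  metric_eq : ∀ p ∈ U, ∀ v w, g p v w = B (fderiv ℝ φ p v) (fderiv ℝ φ p w)

namespace IsFlatChart

variable {U : Set E} {g : E → E → E → ℝ} {φ : E → F} {ψ : F → E} {B : F →L[ℝ] F →L[ℝ] ℝ}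

theorem contDiffAt (h : IsFlatChart U g φ ψ B) {p : E} (hp : p ∈ U) : ContDiffAt ℝ ∞ φ p :=
  h.smooth.contDiffAt (h.isOpen.mem_nhds hp)

theorem differentiableAt (h : IsFlatChart U g φ ψ B) {p : E} (hp : p ∈ U) :
    DifferentiableAt ℝ φ p :=
  (h.contDiffAt hp).differentiableAt (by simp)

theorem contDiffOn_fderiv (h : IsFlatChart U g φ ψ B) : ContDiffOn ℝ ∞ (fderiv ℝ φ) U :=
  h.smooth.fderiv_of_isOpen h.isOpen (by simp)

theorem differentiableAt_fderiv (h : IsFlatChart U g φ ψ B) {p : E} (hp : p ∈ U) :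
    DifferentiableAt ℝ (fderiv ℝ φ) p :=
  (h.contDiffOn_fderiv.contDiffAt (h.isOpen.mem_nhds hp)).differentiableAt (by simp)

theorem fderiv_inv_apply (h : IsFlatChart U g φ ψ B) {p : E} (hp : p ∈ U) (v : E) :
    fderiv ℝ ψ (φ p) (fderiv ℝ φ p v) = v := by
  have h1 : HasFDerivAt (fun x => ψ (φ x)) ((fderiv ℝ ψ (φ p)).comp (fderiv ℝ φ p)) p :=
    ((h.smooth_inv.differentiable (by simp)) (φ p)).hasFDerivAt.comp p
      (h.differentiableAt hp).hasFDerivAt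
  have h2 : HasFDerivAt (fun x => ψ (φ x)) (ContinuousLinearMap.id ℝ E) p :=
    (hasFDerivAt_id p).congr_of_eventuallyEq
      (Filter.eventuallyEq_of_mem (h.isOpen.mem_nhds hp) fun x hx => h.left_inv x hx)
  simpa using congrArg (fun T : E →L[ℝ] E => T v) (h1.unique h2)

theorem fderiv_apply_inv (h : IsFlatChart U g φ ψ B) {p : E} (hp : p ∈ U) (y : F) :
    fderiv ℝ φ p (fderiv ℝ ψ (φ p) y) = y := by
  have h1 : HasFDerivAt (fun x => φ (ψ x)) ((fderiv ℝ φ p).comp (fderiv ℝ ψ (φ p))) (φ p) := by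
    refine HasFDerivAt.comp (φ p) ?_ ((h.smooth_inv.differentiable (by simp)) (φ p)).hasFDerivAt
    rw [h.left_inv p hp]
    exact (h.differentiableAt hp).hasFDerivAt
  have h2 : HasFDerivAt (fun x => φ (ψ x)) (ContinuousLinearMap.id ℝ F) (φ p) := by
    simp only [h.right_inv]
    exact hasFDerivAt_id _
  simpa using congrArg (fun T : F →L[ℝ] F => T y) (h1.unique h2)

theorem fderiv_injective (h : IsFlatChart U g φ ψ B) {p : E} (hp : p ∈ U) :
    Function.Injective (fderiv ℝ φ p) :=
  Function.LeftInverse.injective (h.fderiv_inv_apply hp)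

theorem isRiemannianMetricOn (h : IsFlatChart U g φ ψ B) : IsRiemannianMetricOn U g where
  isOpen := h.isOpen
  add_left p hp u v w := by simp [h.metric_eq p hp]
  smul_left p hp c v w := by simp [h.metric_eq p hp]
  symm p hp v w := by rw [h.metric_eq p hp, h.metric_eq p hp, h.symm]
  pos p hp v hv := by
    rw [h.metric_eq p hp]
    exact h.pos _ fun h0 => hv (h.fderiv_injective hp (by rw [h0, map_zero]))
  smooth v w := by
    have h1 : ContDiffOn ℝ ∞ (fun p => B (fderiv ℝ φ p v) (fderiv ℝ φ p w)) U :=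
      (contDiffOn_const.clm_apply (h.contDiffOn_fderiv.clm_apply contDiffOn_const)).clm_apply
        (h.contDiffOn_fderiv.clm_apply contDiffOn_const)
    exact h1.congr fun p hp => h.metric_eq p hp v w

theorem fderiv_metric (h : IsFlatChart U g φ ψ B) {p : E} (hp : p ∈ U) (v w u : E) :
    fderiv ℝ (fun q => g q v w) p u =
      B (fderiv ℝ (fderiv ℝ φ) p u v) (fderiv ℝ φ p w) +
        B (fderiv ℝ φ p v) (fderiv ℝ (fderiv ℝ φ) p u w) := by
  have hD := (h.differentiableAt_fderiv hp).hasFDerivAt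
  have hv := hD.clm_apply (hasFDerivAt_const v p)
  have hw := hD.clm_apply (hasFDerivAt_const w p)
  have hB := ((hasFDerivAt_const B p).clm_apply hv).clm_apply hw
  have hg := hB.congr_of_eventuallyEq
    (Filter.eventuallyEq_of_mem (h.isOpen.mem_nhds hp) fun q hq => h.metric_eq q hq v w)
  rw [hg.fderiv]
  simp [add_comm]

/-- Differentiating the metric gives six terms. By symmetry of `D²φ` and of `B`, four of them cancel
in pairs and the other two coincide, absorbing the factor `1/2`. -/
theorem christoffelFirst_eq (h : IsFlatChart U g φ ψ B) {p : E} (hp : p ∈ U) (u v w : E) :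
    christoffelFirst g p u v w = B (fderiv ℝ (fderiv ℝ φ) p u v) (fderiv ℝ φ p w) := by
  have hs : IsSymmSndFDerivAt ℝ φ p := (h.contDiffAt hp).isSymmSndFDerivAt (by simpa using ENat.LEInfty.out)
  rw [christoffelFirst, h.fderiv_metric hp, h.fderiv_metric hp, h.fderiv_metric hp,
    hs.eq v u, hs.eq w u, hs.eq w v, h.symm (fderiv ℝ φ p v)]
  ring

theorem hasDerivWithinAt_fderiv_apply (h : IsFlatChart U g φ ψ B) {γ V : ℝ → E}
    (hγ : ContDiffOn ℝ ∞ γ (Icc 0 1)) (hV : ContDiffOn ℝ ∞ V (Icc 0 1)) {t : ℝ}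
    (ht : t ∈ Icc (0 : ℝ) 1) (hγt : γ t ∈ U) :
    HasDerivWithinAt (fun s => fderiv ℝ φ (γ s) (V s))
      (fderiv ℝ (fderiv ℝ φ) (γ t) (velocity γ t) (V t) + fderiv ℝ φ (γ t) (velocity V t))
      (Icc 0 1) t := by
  have h1 : HasDerivWithinAt γ (velocity γ t) (Icc 0 1) t :=
    ((hγ.differentiableOn (by simp)) t ht).hasDerivWithinAt
  have h2 : HasDerivWithinAt V (velocity V t) (Icc 0 1) t :=
    ((hV.differentiableOn (by simp)) t ht).hasDerivWithinAt
  exact ((h.differentiableAt_fderiv hγt).hasFDerivAt.comp_hasDerivWithinAt t h1).clm_apply h2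

/-- The differential of `φ` carries the covariant derivative of `V` to the ordinary derivative of
`dφ(V)`, because the Christoffel term is precisely the product-rule term `D²φ(γ', V)`. -/
theorem isCovDerivAlong_zero_iff (h : IsFlatChart U g φ ψ B) {γ V : ℝ → E}
    (hγ : ContDiffOn ℝ ∞ γ (Icc 0 1)) (hV : ContDiffOn ℝ ∞ V (Icc 0 1)) {t : ℝ}
    (ht : t ∈ Icc (0 : ℝ) 1) (hγt : γ t ∈ U) :
    IsCovDerivAlong g γ V t 0 ↔
      HasDerivWithinAt (fun s => fderiv ℝ φ (γ s) (V s)) 0 (Icc 0 1) t := by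
  have hd := h.hasDerivWithinAt_fderiv_apply hγ hV ht hγt
  set A := fderiv ℝ (fderiv ℝ φ) (γ t) (velocity γ t) (V t) + fderiv ℝ φ (γ t) (velocity V t)
    with hA
  have key : IsCovDerivAlong g γ V t 0 ↔ ∀ w, B A (fderiv ℝ φ (γ t) w) = 0 := by
    refine forall_congr' fun w => ?_
    rw [h.metric_eq _ hγt, h.metric_eq _ hγt, h.christoffelFirst_eq hγt, hA]
    simp only [map_zero, map_add, zero_apply, add_apply]
    rw [eq_comm, add_comm]
  rw [key]
  constructor
  · intro hw
    have hA0 : A = 0 := by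
      by_contra hne
      -- The test vector is chosen so that its image under `dφ` is `A` itself, giving `B A A = 0`.
      have := hw (fderiv ℝ ψ (φ (γ t)) A)
      rw [h.fderiv_apply_inv hγt] at this
      exact (h.pos A hne).ne' this
    rwa [hA0] at hd
  · intro h0 w
    have huniq : UniqueDiffWithinAt ℝ (Icc (0 : ℝ) 1) t := uniqueDiffOn_Icc_zero_one t ht
    have : A = 0 := by rw [← hd.derivWithin huniq, h0.derivWithin huniq]
    simp [this]

theorem isParallelAlong_iff (h : IsFlatChart U g φ ψ B) {γ V : ℝ → E}
    (hγ : ContDiffOn ℝ ∞ γ (Icc 0 1)) (hV : ContDiffOn ℝ ∞ V (Icc 0 1))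
    (hmem : ∀ t ∈ Icc (0 : ℝ) 1, γ t ∈ U) :
    IsParallelAlong g γ V ↔
      ∀ t ∈ Icc (0 : ℝ) 1, fderiv ℝ φ (γ t) (V t) = fderiv ℝ φ (γ 0) (V 0) := by
  constructor
  · intro hp
    have hd : ∀ t ∈ Icc (0 : ℝ) 1,
        HasDerivWithinAt (fun s => fderiv ℝ φ (γ s) (V s)) 0 (Icc 0 1) t := fun t ht =>
      (h.isCovDerivAlong_zero_iff hγ hV ht (hmem t ht)).1 (hp.covDeriv_eq_zero t ht)
    exact constant_of_derivWithin_zero (fun t ht => (hd t ht).differentiableWithinAt)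
      fun t ht => (hd t (Ico_subset_Icc_self ht)).derivWithin
        (uniqueDiffOn_Icc_zero_one t (Ico_subset_Icc_self ht))
  · intro hc
    refine ⟨hV, fun t ht => (h.isCovDerivAlong_zero_iff hγ hV ht (hmem t ht)).2 ?_⟩
    exact (hasDerivWithinAt_const t (Icc 0 1) (fderiv ℝ φ (γ 0) (V 0))).congr hc (hc t ht)

theorem transports_iff (h : IsFlatChart U g φ ψ B) {γ : ℝ → E}
    (hγ : ContDiffOn ℝ ∞ γ (Icc 0 1)) (hmem : ∀ t ∈ Icc (0 : ℝ) 1, γ t ∈ U) (v w : E) :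
    Transports g γ v w ↔ fderiv ℝ φ (γ 1) w = fderiv ℝ φ (γ 0) v := by
  have m0 : (0 : ℝ) ∈ Icc (0 : ℝ) 1 := by simp
  have m1 : (1 : ℝ) ∈ Icc (0 : ℝ) 1 := by simp
  constructor
  · rintro ⟨V, hV, rfl, rfl⟩
    exact (h.isParallelAlong_iff hγ hV.smooth hmem).1 hV 1 m1
  · intro heq
    -- The candidate parallel field is the constant vector `dφ(v)` pulled back along the curve by
    -- the differential of `ψ`.
    have hV : ContDiffOn ℝ ∞ (fun t => fderiv ℝ ψ (φ (γ t)) (fderiv ℝ φ (γ 0) v)) (Icc 0 1) :=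
      (((h.smooth_inv.fderiv_right (m := ∞) (by simp)).comp_contDiffOn
        (h.smooth.comp hγ hmem)).clm_apply contDiffOn_const)
    refine ⟨_, (h.isParallelAlong_iff hγ hV hmem).2 fun t ht => ?_, ?_, ?_⟩
    · rw [h.fderiv_apply_inv (hmem t ht), h.fderiv_apply_inv (hmem 0 m0)]
    · exact h.fderiv_inv_apply (hmem 0 m0) v
    · rw [← heq, h.fderiv_inv_apply (hmem 1 m1)]

/-- The chart is onto the whole vector space, so the segment from `φ p` to `φ q` stays in its range
and lifts through `ψ`; its velocity is constant in the chart. -/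
theorem exists_isGeodesic (h : IsFlatChart U g φ ψ B) {p q : E} (hp : p ∈ U) (hq : q ∈ U) :
    ∃ γ, IsGeodesic U g p q γ := by
  set ℓ : ℝ → F := fun t => φ p + t • (φ q - φ p) with hℓ
  have hℓs : ContDiff ℝ ∞ ℓ := contDiff_const.add (contDiff_id.smul contDiff_const)
  have hγ : ContDiffOn ℝ ∞ (fun t => ψ (ℓ t)) (Icc 0 1) := (h.smooth_inv.comp hℓs).contDiffOn
  have hv : ContDiffOn ℝ ∞ (velocity fun t => ψ (ℓ t)) (Icc 0 1) :=
    hγ.derivWithin uniqueDiffOn_Icc_zero_one (by simp)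
  have hconst : ∀ t ∈ Icc (0 : ℝ) 1,
      fderiv ℝ φ (ψ (ℓ t)) (velocity (fun t => ψ (ℓ t)) t) = φ q - φ p := by
    intro t ht
    have hu : UniqueDiffWithinAt ℝ (Icc (0 : ℝ) 1) t := uniqueDiffOn_Icc_zero_one t ht
    have h1 : HasDerivWithinAt (fun t => ψ (ℓ t)) (velocity (fun t => ψ (ℓ t)) t) (Icc 0 1) t :=
      ((hγ.differentiableOn (by simp)) t ht).hasDerivWithinAt
    have h2 : HasDerivWithinAt (fun t => φ (ψ (ℓ t))) _ (Icc 0 1) t :=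
      (h.differentiableAt (h.mem (ℓ t))).hasFDerivAt.comp_hasDerivWithinAt t h1
    have h3 : HasDerivWithinAt (fun t => φ (ψ (ℓ t))) (φ q - φ p) (Icc 0 1) t := by
      simp only [h.right_inv, hℓ]
      simpa using (((hasDerivAt_id t).smul_const (φ q - φ p)).const_add (φ p)).hasDerivWithinAt
    rw [← h2.derivWithin hu, h3.derivWithin hu]
  refine ⟨fun t => ψ (ℓ t), hγ, fun t _ => h.mem _, ?_, ?_, ?_⟩
  · simp [hℓ, h.left_inv p hp]
  · simp [hℓ, h.left_inv q hq]
  · refine (h.isParallelAlong_iff hγ hv fun t _ => h.mem _).2 fun t ht => ?_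
    rw [hconst t ht, hconst 0 (by simp)]

end IsFlatChart

end Flat

end LogCholesky

namespace LogCholesky

variable {m : ℕ}

/-! ### The flat chart of the Cholesky space -/

noncomputable section

/-- Continuous linear maps for the norm topologies. On submodules of matrices this spelling avoids
the subspace topology of the product topology, which is equal to the norm topology only after
unfolding. -/
abbrev NormCLM (E F : Type*) [NormedAddCommGroup E] [NormedSpace ℝ E] [NormedAddCommGroup F]
    [NormedSpace ℝ F] : Type _ := E →L[ℝ] F

/-- A linear map on a finite-dimensional space as a continuous linear map. -/
def finCLM {E F : Type*} [NormedAddCommGroup E] [NormedSpace ℝ E] [NormedAddCommGroup F]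
    [NormedSpace ℝ F] [FiniteDimensional ℝ E] (f : E →ₗ[ℝ] F) : NormCLM E F :=
  LinearMap.toContinuousLinearMap f

/-- A bilinear map on finite-dimensional spaces as a continuous bilinear map. -/
def finCLM₂ {E F G : Type*} [NormedAddCommGroup E] [NormedSpace ℝ E] [NormedAddCommGroup F]
    [NormedSpace ℝ F] [NormedAddCommGroup G] [NormedSpace ℝ G] [FiniteDimensional ℝ E]
    [FiniteDimensional ℝ F] (f : E →ₗ[ℝ] F →ₗ[ℝ] G) : NormCLM E (NormCLM F G) :=
  LinearMap.toContinuousBilinearMap f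

/-! ### Scalar functions applied to selected coordinates -/

section CoordMap

variable {ι E : Type*} [Fintype ι] [NormedAddCommGroup E] [NormedSpace ℝ E]

/-- Apply `f` to the coordinates `ℓ i` in the directions `e i`. -/
def coordMap (ℓ : ι → NormCLM E ℝ) (e : ι → E) (f : ℝ → ℝ) (x : E) : E :=
  x + ∑ i, (f (ℓ i x) - ℓ i x) • e i

/-- Scale the coordinates `ℓ i` in the directions `e i`. -/
def coordScale (ℓ : ι → NormCLM E ℝ) (e : ι → E) (d : ι → ℝ) : NormCLM E E :=
  ContinuousLinearMap.id ℝ _ + ∑ i, (d i • ℓ i - ℓ i).smulRight (e i)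

theorem coordScale_apply (ℓ : ι → NormCLM E ℝ) (e : ι → E) (d : ι → ℝ) (x : E) :
    coordScale ℓ e d x = x + ∑ i, (d i * ℓ i x - ℓ i x) • e i := by
  simp [coordScale]

theorem contDiffAt_coordMap {ℓ : ι → NormCLM E ℝ} {e : ι → E} {f : ℝ → ℝ} {x : E}
    (hf : ∀ i, ContDiffAt ℝ ∞ f (ℓ i x)) : ContDiffAt ℝ ∞ (coordMap ℓ e f) x := by
  refine contDiffAt_id.add (ContDiffAt.sum fun i _ => ContDiffAt.smul ?_ contDiffAt_const)
  exact ((hf i).comp x (ℓ i).contDiff.contDiffAt).sub (ℓ i).contDiff.contDiffAt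

theorem hasFDerivAt_coordMap {ℓ : ι → NormCLM E ℝ} {e : ι → E} {f : ℝ → ℝ} {d : ι → ℝ} {x : E}
    (hf : ∀ i, HasDerivAt f (d i) (ℓ i x)) :
    HasFDerivAt (coordMap ℓ e f) (coordScale ℓ e d) x := by
  refine (hasFDerivAt_id x).add (HasFDerivAt.fun_sum fun i _ => HasFDerivAt.smul_const ?_ _)
  exact ((hf i).comp_hasFDerivAt x (ℓ i).hasFDerivAt).sub (ℓ i).hasFDerivAt

end CoordMap

/-- The `i`-th diagonal entry as a continuous linear functional. -/
def diagEntry (i : Fin m) : NormCLM (lowerTri m) ℝ :=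
  finCLM
    { toFun := fun L => (L : Matrix (Fin m) (Fin m) ℝ) i i
      map_add' := fun _ _ => rfl
      map_smul' := fun _ _ => rfl }

theorem diagEntry_apply (i : Fin m) (L : lowerTri m) :
    diagEntry i L = (L : Matrix (Fin m) (Fin m) ℝ) i i := rfl

/-- The matrix unit at the diagonal position `i`. -/
def diagUnit (i : Fin m) : lowerTri m :=
  ⟨Matrix.diagonal (Pi.single i 1), fun _ _ hij => Matrix.diagonal_apply_ne _ hij.ne⟩

/-- Apply `f` to the diagonal entries. -/
def mapDiag (f : ℝ → ℝ) (L : lowerTri m) : lowerTri m :=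
  coordMap diagEntry diagUnit f L

/-- Scale the diagonal entries by `d`. -/
def scaleDiag (d : Fin m → ℝ) : NormCLM (lowerTri m) (lowerTri m) :=
  coordScale diagEntry diagUnit d

theorem add_sum_smul_diagUnit_apply (L : lowerTri m) (c : Fin m → ℝ) (i j : Fin m) :
    ((L + ∑ k, c k • diagUnit k : lowerTri m) : Matrix (Fin m) (Fin m) ℝ) i j =
      if i = j then (L : Matrix (Fin m) (Fin m) ℝ) i i + c i
        else (L : Matrix (Fin m) (Fin m) ℝ) i j := by
  have h : ((∑ k, c k • diagUnit k : lowerTri m) : Matrix (Fin m) (Fin m) ℝ) =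
      Matrix.diagonal c := by
    ext a b
    rw [Submodule.coe_sum, Matrix.sum_apply]
    by_cases hab : a = b
    · subst hab
      simp [diagUnit, Pi.single_apply]
    · simp [diagUnit, hab]
  rw [Submodule.coe_add, h]
  by_cases hij : i = j
  · subst hij; simp
  · simp [hij]

theorem mapDiag_apply (f : ℝ → ℝ) (L : lowerTri m) (i j : Fin m) :
    (mapDiag f L : Matrix (Fin m) (Fin m) ℝ) i j =
      if i = j then f ((L : Matrix (Fin m) (Fin m) ℝ) i i)
        else (L : Matrix (Fin m) (Fin m) ℝ) i j := by
  rw [mapDiag, coordMap, add_sum_smul_diagUnit_apply]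
  simp [diagEntry_apply]

theorem scaleDiag_apply (d : Fin m → ℝ) (X : lowerTri m) (i j : Fin m) :
    (scaleDiag d X : Matrix (Fin m) (Fin m) ℝ) i j =
      if i = j then d i * (X : Matrix (Fin m) (Fin m) ℝ) i i
        else (X : Matrix (Fin m) (Fin m) ℝ) i j := by
  rw [scaleDiag, coordScale_apply, add_sum_smul_diagUnit_apply]
  simp [diagEntry_apply]

/-- The Frobenius inner product on lower triangular matrices as a continuous bilinear form. -/
def frobForm (m : ℕ) : NormCLM (lowerTri m) (NormCLM (lowerTri m) ℝ) :=
  finCLM₂ <|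
    LinearMap.mk₂ ℝ (fun X Y : lowerTri m => frobInner (X : Matrix (Fin m) (Fin m) ℝ) Y)
      (fun X X' Y => by simp [frobInner, add_mul, Finset.sum_add_distrib])
      (fun c X Y => by simp [frobInner, mul_assoc, Finset.mul_sum])
      (fun X Y Y' => by simp [frobInner, mul_add, Finset.sum_add_distrib])
      (fun c X Y => by simp [frobInner, mul_left_comm, Finset.mul_sum])

theorem frobForm_apply (X Y : lowerTri m) :
    frobForm m X Y = frobInner (X : Matrix (Fin m) (Fin m) ℝ) Y := rfl

theorem frobForm_pos (X : lowerTri m) (hX : X ≠ 0) : 0 < frobForm m X X := by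
  rw [frobForm_apply]
  have hn : ∀ i j, 0 ≤ (X : Matrix (Fin m) (Fin m) ℝ) i j * (X : Matrix (Fin m) (Fin m) ℝ) i j :=
    fun i j => mul_self_nonneg _
  have h0 : 0 ≤ frobInner (X : Matrix (Fin m) (Fin m) ℝ) X :=
    Finset.sum_nonneg fun i _ => Finset.sum_nonneg fun j _ => hn i j
  refine h0.lt_of_ne' fun h => hX ?_
  ext i j
  have h1 := (Finset.sum_eq_zero_iff_of_nonneg
    fun i _ => Finset.sum_nonneg fun j _ => hn i j).1 h i (Finset.mem_univ i)
  have h2 := (Finset.sum_eq_zero_iff_of_nonneg fun j _ => hn i j).1 h1 j (Finset.mem_univ j)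
  simpa using h2

theorem isOpen_choleskySpace : IsOpen (choleskySpace m) := by
  have : choleskySpace m = ⋂ i, {L | 0 < diagEntry i L} := by
    ext L; simp [choleskySpace, diagEntry_apply]
  rw [this]
  exact isOpen_iInter_of_finite fun i => isOpen_lt continuous_const (diagEntry i).continuous

theorem inv_diagPart {L : lowerTri m} (hL : L ∈ choleskySpace m) :
    (diagPart (L : Matrix (Fin m) (Fin m) ℝ))⁻¹ =
      Matrix.diagonal fun i => ((L : Matrix (Fin m) (Fin m) ℝ) i i)⁻¹ := by
  refine Matrix.inv_eq_right_inv ?_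
  rw [diagPart, Matrix.diagonal_mul_diagonal, ← Matrix.diagonal_one]
  congr 1
  funext i
  exact mul_inv_cancel₀ (hL i).ne'

theorem hasFDerivAt_mapDiag_log {L : lowerTri m} (hL : L ∈ choleskySpace m) :
    HasFDerivAt (mapDiag Real.log)
      (scaleDiag fun i => ((L : Matrix (Fin m) (Fin m) ℝ) i i)⁻¹) L :=
  hasFDerivAt_coordMap fun i => Real.hasDerivAt_log (hL i).ne'

/-- Strictly lower and diagonal parts have disjoint supports, so at each entry at most one of the
two summands of the metric survives. -/
theorem cholMetric_eq_frobForm {L : lowerTri m} (hL : L ∈ choleskySpace m) (X Y : lowerTri m) :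
    cholMetric L X Y =
      frobForm m (scaleDiag (fun i => ((L : Matrix (Fin m) (Fin m) ℝ) i i)⁻¹) X)
        (scaleDiag (fun i => ((L : Matrix (Fin m) (Fin m) ℝ) i i)⁻¹) Y) := by
  rw [cholMetric, frobForm_apply, inv_diagPart hL]
  simp only [frobInner, ← Finset.sum_add_distrib]
  refine Finset.sum_congr rfl fun i _ => Finset.sum_congr rfl fun j _ => ?_
  rw [scaleDiag_apply, scaleDiag_apply]
  rcases lt_trichotomy i j with h | rfl | h
  · simp [lowPart, diagPart, h.ne, h.not_gt, X.2 i j h]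
  · simp [lowPart, diagPart]
  · simp [lowPart, diagPart, h.ne', h]

theorem mapDiag_exp_mem (Y : lowerTri m) : mapDiag Real.exp Y ∈ choleskySpace m := by
  intro i
  rw [mapDiag_apply, if_pos rfl]
  exact Real.exp_pos _

theorem mapDiag_log_exp (Y : lowerTri m) : mapDiag Real.log (mapDiag Real.exp Y) = Y := by
  ext i j
  simp only [mapDiag_apply, if_true, Real.log_exp]
  split_ifs with h
  · rw [h]
  · rfl

theorem mapDiag_exp_log {L : lowerTri m} (hL : L ∈ choleskySpace m) :
    mapDiag Real.exp (mapDiag Real.log L) = L := by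
  ext i j
  simp only [mapDiag_apply, if_true, Real.exp_log (hL i)]
  split_ifs with h
  · rw [h]
  · rfl

theorem isFlatChart_cholMetric :
    IsFlatChart (choleskySpace m) cholMetric (mapDiag Real.log) (mapDiag Real.exp)
      (frobForm m) where
  isOpen := isOpen_choleskySpace
  smooth L hL :=
    (contDiffAt_coordMap fun i => Real.contDiffAt_log.2 (hL i).ne').contDiffWithinAt
  smooth_inv := contDiff_iff_contDiffAt.2 fun _ =>
    contDiffAt_coordMap fun _ => Real.contDiff_exp.contDiffAt
  mem := mapDiag_exp_mem
  right_inv := mapDiag_log_exp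
  left_inv _ hL := mapDiag_exp_log hL
  symm X Y := by simp only [frobForm_apply, frobInner, mul_comm]
  pos := frobForm_pos
  metric_eq L hL X Y := by
    rw [(hasFDerivAt_mapDiag_log hL).fderiv, cholMetric_eq_frobForm hL]

theorem scaleDiag_eq_iff {L K : lowerTri m} (hL : L ∈ choleskySpace m) (hK : K ∈ choleskySpace m)
    (X Y : lowerTri m) :
    scaleDiag (fun i => ((K : Matrix (Fin m) (Fin m) ℝ) i i)⁻¹) Y =
        scaleDiag (fun i => ((L : Matrix (Fin m) (Fin m) ℝ) i i)⁻¹) X ↔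
      (Y : Matrix (Fin m) (Fin m) ℝ) = transportFormula L K X := by
  rw [← Subtype.coe_inj, ← Matrix.ext_iff, ← Matrix.ext_iff]
  refine forall_congr' fun i => forall_congr' fun j => ?_
  rw [scaleDiag_apply, scaleDiag_apply, transportFormula, inv_diagPart hL, diagPart, diagPart,
    Matrix.diagonal_mul_diagonal, Matrix.diagonal_mul_diagonal, Matrix.add_apply]
  have hKi := (hK i).ne'
  rcases lt_trichotomy i j with h | rfl | h
  · simp [lowPart, h.ne, h.not_gt, X.2 i j h, Y.2 i j h]
  · simp only [lowPart, if_true, Matrix.of_apply, lt_irrefl, if_false, Matrix.diagonal_apply_eq,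
      zero_add, mul_assoc]
    exact inv_mul_eq_iff_eq_mul₀ hKi
  · simp [lowPart, h.ne', h]

end

end LogCholesky

namespace LogCholesky

/-! ### Transferring a flat chart along a diffeomorphism -/

section Transfer

variable {E F G : Type*} [NormedAddCommGroup E] [NormedSpace ℝ E] [NormedAddCommGroup F]
  [NormedSpace ℝ F] [NormedAddCommGroup G] [NormedSpace ℝ G]

theorem hasFDerivAt_apply_self (b : NormCLM E (NormCLM E F)) (x : E) :
    HasFDerivAt (fun y => b y y) (b.flip x + b x) x := by
  have h := b.hasFDerivAt (x := x) |>.clm_apply (hasFDerivAt_id x)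
  refine h.congr_fderiv ?_
  ext v
  simp [add_comm]

theorem contDiff_apply_self (b : NormCLM E (NormCLM E F)) : ContDiff ℝ ∞ fun y => b y y :=
  b.contDiff.clm_apply contDiff_id

/-- The inverse function theorem for a global left inverse `χ` of `s`. -/
theorem contDiffAt_leftInverse [FiniteDimensional ℝ E] {U : Set E} (hU : IsOpen U) {s : E → F}
    {χ : F → E} (hs : ContDiff ℝ ∞ s) (hχ : ∀ x ∈ U, χ (s x) = x) {x : E} (hx : x ∈ U)
    {T : NormCLM E F} (hT : HasFDerivAt s T x) {inv : F → E} (hl : ∀ v, inv (T v) = v)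
    (hr : ∀ w, T (inv w) = w) :
    s '' U ∈ nhds (s x) ∧ ContDiffAt ℝ ∞ χ (s x) ∧ ∀ w, fderiv ℝ χ (s x) w = inv w := by
  have := FiniteDimensional.complete ℝ E
  let e : E ≃L[ℝ] F := (LinearEquiv.ofBijective (T : E →ₗ[ℝ] F)
    ⟨Function.LeftInverse.injective hl, Function.RightInverse.surjective hr⟩).toContinuousLinearEquiv
  have he : HasFDerivAt s (e : E →L[ℝ] F) x := hT
  have hse : HasStrictFDerivAt s (e : E →L[ℝ] F) x := hs.contDiffAt.hasStrictFDerivAt' he (by simp)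
  -- No continuity of `χ` is assumed. Near `s x` the local inverse takes values in `U`, where `χ ∘
  -- s` is the identity, so `χ` must agree with it.
  have hev : χ =ᶠ[nhds (s x)] hse.localInverse s e x := by
    have hc : ∀ᶠ y in nhds (s x), hse.localInverse s e x y ∈ U :=
      hse.localInverse_tendsto.eventually (hU.mem_nhds hx)
    filter_upwards [hc, hse.eventually_right_inverse] with y hy hy'
    rw [← hχ _ hy, hy']
  refine ⟨?_, ?_, fun w => ?_⟩
  · rw [← hse.map_nhds_eq_of_equiv]
    exact Filter.image_mem_map (hU.mem_nhds hx)
  · exact (hs.contDiffAt.to_localInverse he (by simp)).congr_of_eventuallyEq hev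
  · rw [(hse.to_localInverse.hasFDerivAt.congr_of_eventuallyEq hev).fderiv]
    refine e.injective ?_
    exact (e.apply_symm_apply w).trans (hr w).symm

variable {U : Set E} {g : E → E → E → ℝ} {φ : E → G} {ψ : G → E} {B : G →L[ℝ] G →L[ℝ] ℝ}
  {V : Set F} {g' : F → F → F → ℝ} {s : E → F} {χ : F → E} {T : E → NormCLM E F}
  {inv : E → F → E}

theorem IsFlatChart.fderiv_comp (h : IsFlatChart U g φ ψ B) [FiniteDimensional ℝ E]
    (hs : ContDiff ℝ ∞ s) (hχ : ∀ x ∈ U, χ (s x) = x) (hχm : ∀ y ∈ V, χ y ∈ U)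
    (hsχ : ∀ y ∈ V, s (χ y) = y) (hT : ∀ x, HasFDerivAt s (T x) x)
    (hl : ∀ x ∈ U, ∀ v, inv x (T x v) = v) (hr : ∀ x ∈ U, ∀ w, T x (inv x w) = w)
    {y : F} (hy : y ∈ V) (w : F) :
    fderiv ℝ (fun z => φ (χ z)) y w = fderiv ℝ φ (χ y) (inv (χ y) w) := by
  have hx := hχm y hy
  obtain ⟨-, h2, h3⟩ := contDiffAt_leftInverse h.isOpen hs hχ hx (hT _) (hl _ hx) (hr _ hx)
  rw [hsχ y hy] at h2 h3
  have := (h.differentiableAt hx).hasFDerivAt.comp y (h2.differentiableAt (by simp)).hasFDerivAt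
  rw [← h3 w]
  exact congrArg (fun S : F →L[ℝ] G => S w) this.fderiv

/-- Openness of `V` and smoothness of `χ` are conclusions here: both come from the inverse function
theorem for `s`. -/
theorem IsFlatChart.transfer (h : IsFlatChart U g φ ψ B) [FiniteDimensional ℝ E]
    (hs : ContDiff ℝ ∞ s) (hsm : ∀ x ∈ U, s x ∈ V) (hχ : ∀ x ∈ U, χ (s x) = x)
    (hχm : ∀ y ∈ V, χ y ∈ U) (hsχ : ∀ y ∈ V, s (χ y) = y) (hT : ∀ x, HasFDerivAt s (T x) x)
    (hl : ∀ x ∈ U, ∀ v, inv x (T x v) = v) (hr : ∀ x ∈ U, ∀ w, T x (inv x w) = w)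
    (hg : ∀ y ∈ V, ∀ v w, g' y v w = g (χ y) (inv (χ y) v) (inv (χ y) w)) :
    IsFlatChart V g' (fun y => φ (χ y)) (fun z => s (ψ z)) B where
  isOpen := by
    rw [isOpen_iff_mem_nhds]
    intro y hy
    have hx := hχm y hy
    obtain ⟨h1, -, -⟩ := contDiffAt_leftInverse h.isOpen hs hχ hx (hT _) (hl _ hx) (hr _ hx)
    rw [hsχ y hy] at h1
    exact Filter.mem_of_superset h1 (image_subset_iff.2 hsm)
  smooth y hy := by
    have hx := hχm y hy
    obtain ⟨-, h2, -⟩ := contDiffAt_leftInverse h.isOpen hs hχ hx (hT _) (hl _ hx) (hr _ hx)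
    rw [hsχ y hy] at h2
    exact ((h.contDiffAt hx).comp y h2).contDiffWithinAt
  smooth_inv := hs.comp h.smooth_inv
  mem z := hsm _ (h.mem z)
  right_inv z := by rw [hχ _ (h.mem z), h.right_inv]
  left_inv y hy := by rw [h.left_inv _ (hχm y hy), hsχ y hy]
  symm := h.symm
  pos := h.pos
  metric_eq y hy v w := by
    rw [hg y hy, h.metric_eq _ (hχm y hy), h.fderiv_comp hs hχ hχm hsχ hT hl hr hy,
      h.fderiv_comp hs hχ hχm hsχ hT hl hr hy]

end Transfer

/-! ### The Cholesky factorization -/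

noncomputable section

variable {m : ℕ}

theorem det_ne_zero {L : lowerTri m} (hL : L ∈ choleskySpace m) :
    (L : Matrix (Fin m) (Fin m) ℝ).det ≠ 0 := by
  rw [Matrix.det_of_isLowerTriangular _ fun i j hij => L.2 i j hij]
  exact Finset.prod_ne_zero_iff.2 fun i _ => (hL i).ne'

theorem inv_mem_lowerTri {M : Matrix (Fin m) (Fin m) ℝ} (hM : M ∈ lowerTri m) (hd : M.det ≠ 0) :
    M⁻¹ ∈ lowerTri m := by
  have := M.invertibleOfIsUnitDet hd.isUnit
  have h : M.BlockTriangular OrderDual.toDual := fun i j hij => hM i j hij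
  exact fun i j hij => Matrix.blockTriangular_inv_of_blockTriangular h hij

theorem mul_mem_lowerTri {M N : Matrix (Fin m) (Fin m) ℝ} (hM : M ∈ lowerTri m)
    (hN : N ∈ lowerTri m) : M * N ∈ lowerTri m := by
  have h : M.BlockTriangular OrderDual.toDual := fun i j hij => hM i j hij
  have h' : N.BlockTriangular OrderDual.toDual := fun i j hij => hN i j hij
  exact fun i j hij => h.mul h' hij

theorem exists_cholesky {P : Matrix (Fin m) (Fin m) ℝ} (hP : P.PosDef) :
    ∃ L ∈ choleskySpace m,
      (L : Matrix (Fin m) (Fin m) ℝ) * (L : Matrix (Fin m) (Fin m) ℝ)ᵀ = P := by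
  set A := LDL.lowerInv hP with hA
  set M := LDL.lower hP with hM
  set d := LDL.diagEntries hP with hd
  have hAdet : A.det ≠ 0 := (Matrix.isUnit_det_of_invertible A).ne_zero
  have hAtri : A ∈ lowerTri m := fun i j hij => LDL.lowerInv_triangular hP hij
  have hMtri : M ∈ lowerTri m := inv_mem_lowerTri hAtri hAdet
  have hMdet : M.det ≠ 0 := by
    rw [hM, LDL.lower]
    exact ((Matrix.isUnit_nonsing_inv_det_iff).2 hAdet.isUnit).ne_zero
  have hMi : ∀ i, M i i ≠ 0 := by
    rw [Matrix.det_of_isLowerTriangular _ fun i j hij => hMtri i j hij] at hMdet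
    exact fun i => Finset.prod_ne_zero_iff.1 hMdet i (Finset.mem_univ i)
  have hdpos : ∀ i, 0 < d i := by
    have h1 : (Matrix.diagonal d).PosDef := by
      have h2 : Matrix.diagonal d = A * P * Aᴴ := LDL.diag_eq_lowerInv_conj hP
      rw [h2]
      refine hP.mul_mul_conjTranspose_same ?_
      exact Matrix.vecMul_injective_of_isUnit ((Matrix.isUnit_iff_isUnit_det A).2 hAdet.isUnit)
    exact Matrix.posDef_diagonal_iff.1 h1
  have hdec : M * Matrix.diagonal d * Mᵀ = P := LDL.lower_conj_diag hP
  -- A square root of `d i` carrying the sign of `M i i`, so that `M * diagonal c` has positive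
  -- diagonal.
  let c : Fin m → ℝ := fun i => √(d i) * (|M i i| / M i i)
  have hc : ∀ i, c i * c i = d i := fun i => by
    have h1 : (|M i i| / M i i) * (|M i i| / M i i) = 1 := by
      rw [div_mul_div_comm, abs_mul_abs_self, div_self (mul_self_ne_zero.2 (hMi i))]
    calc c i * c i = (√(d i) * √(d i)) * ((|M i i| / M i i) * (|M i i| / M i i)) := by
          simp only [c]; ring
      _ = d i := by rw [h1, Real.mul_self_sqrt (hdpos i).le, mul_one]
  have hdiag : Matrix.diagonal c ∈ lowerTri m := fun i j hij => Matrix.diagonal_apply_ne _ hij.ne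
  refine ⟨⟨M * Matrix.diagonal c, mul_mem_lowerTri hMtri hdiag⟩, fun i => ?_, ?_⟩
  · have h1 : M i i * c i = √(d i) * |M i i| := by
      have := hMi i
      simp only [c]; field_simp
    change 0 < (M * Matrix.diagonal c) i i
    rw [Matrix.mul_diagonal, h1]
    exact mul_pos (Real.sqrt_pos.2 (hdpos i)) (abs_pos.2 (hMi i))
  · change M * Matrix.diagonal c * (M * Matrix.diagonal c)ᵀ = P
    rw [Matrix.transpose_mul, Matrix.diagonal_transpose, Matrix.mul_assoc,
      ← Matrix.mul_assoc (Matrix.diagonal c), Matrix.diagonal_mul_diagonal, ← Matrix.mul_assoc]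
    simpa only [hc] using hdec

/-- The quotient `N = K⁻¹ L` is lower triangular and orthogonal, so `Nᵀ = N⁻¹` is lower triangular
too. Hence `N` is diagonal with entries `±1`, and positivity of both diagonals forces `N = 1`. -/
theorem cholesky_unique {L K : lowerTri m} (hL : L ∈ choleskySpace m) (hK : K ∈ choleskySpace m)
    (h : (L : Matrix (Fin m) (Fin m) ℝ) * (L : Matrix (Fin m) (Fin m) ℝ)ᵀ =
      (K : Matrix (Fin m) (Fin m) ℝ) * (K : Matrix (Fin m) (Fin m) ℝ)ᵀ) : L = K := by
  obtain ⟨A, hA⟩ := L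
  obtain ⟨C, hC⟩ := K
  have hCd : C.det ≠ 0 := det_ne_zero hK
  have hCu := hCd.isUnit
  change A * Aᵀ = C * Cᵀ at h
  set N := C⁻¹ * A with hN
  have hNlow : N ∈ lowerTri m := mul_mem_lowerTri (inv_mem_lowerTri hC hCd) hA
  have hCN : C * N = A := by rw [hN, Matrix.mul_nonsing_inv_cancel_left _ _ hCu]
  have hNN : N * Nᵀ = 1 := by
    rw [hN, Matrix.transpose_mul, Matrix.mul_assoc, ← Matrix.mul_assoc A, h, Matrix.mul_assoc,
      ← Matrix.transpose_mul, Matrix.nonsing_inv_mul _ hCu, Matrix.transpose_one, Matrix.mul_one,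
      Matrix.nonsing_inv_mul _ hCu]
  have hNd : N.det ≠ 0 := fun h0 => by
    have := congrArg Matrix.det hNN
    simp [h0] at this
  have hNt : Nᵀ ∈ lowerTri m := by
    rw [← Matrix.inv_eq_right_inv hNN]
    exact inv_mem_lowerTri hNlow hNd
  have hdiag : N = Matrix.diagonal fun i => N i i := by
    ext i j
    rcases lt_trichotomy i j with hij | rfl | hij
    · rw [hNlow i j hij, Matrix.diagonal_apply_ne _ hij.ne]
    · simp
    · rw [Matrix.diagonal_apply_ne _ hij.ne']
      exact hNt j i hij
  have hone : ∀ i, N i i = 1 := fun i => by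
    have h1 : N i i * N i i = 1 := by
      have := congrFun (congrFun hNN i) i
      rw [hdiag, Matrix.diagonal_transpose, Matrix.diagonal_mul_diagonal] at this
      simpa using this
    have h2 : C i i * N i i = A i i := by
      have := congrFun (congrFun hCN i) i
      rw [hdiag, Matrix.mul_diagonal] at this
      exact this
    have h3 : 0 < N i i := by
      have hc : 0 < C i i := hK i
      have ha : 0 < A i i := hL i
      rw [← h2] at ha
      exact pos_of_mul_pos_right ha hc.le
    nlinarith
  ext1
  change A = C
  rw [← hCN, hdiag]
  simp [hone]

theorem cholesky_spec {P : symMat m} (hP : P ∈ spd m) :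
    cholesky P ∈ choleskySpace m ∧
      (cholesky P : Matrix (Fin m) (Fin m) ℝ) * (cholesky P : Matrix (Fin m) (Fin m) ℝ)ᵀ = P := by
  have h := exists_cholesky hP
  rw [cholesky, dif_pos h]
  exact h.choose_spec

/-! ### The flat chart of the Log-Cholesky metric -/

/-- The symmetrized product `(X Yᵀ + Y Xᵀ) / 2`. -/
def symProd (m : ℕ) : NormCLM (lowerTri m) (NormCLM (lowerTri m) (symMat m)) :=
  finCLM₂ <|
    LinearMap.mk₂ ℝ (fun X Y : lowerTri m =>
        (⟨(1 / 2 : ℝ) • ((X : Matrix (Fin m) (Fin m) ℝ) * (Y : Matrix (Fin m) (Fin m) ℝ)ᵀ +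
          (Y : Matrix (Fin m) (Fin m) ℝ) * (X : Matrix (Fin m) (Fin m) ℝ)ᵀ),
          Matrix.IsSymm.smul (by
            rw [Matrix.IsSymm, Matrix.transpose_add, Matrix.transpose_mul, Matrix.transpose_mul,
              Matrix.transpose_transpose, Matrix.transpose_transpose, add_comm]) _⟩ : symMat m))
      (fun X X' Y => by
        ext1; simp only [Submodule.coe_add, Matrix.transpose_add, mul_add, add_mul, smul_add]; abel)
      (fun c X Y => by
        ext1
        simp only [Submodule.coe_smul, Matrix.transpose_smul, Matrix.smul_mul, Matrix.mul_smul,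
          ← smul_add]
        rw [smul_comm])
      (fun X Y Y' => by
        ext1; simp only [Submodule.coe_add, Matrix.transpose_add, mul_add, add_mul, smul_add]; abel)
      (fun c X Y => by
        ext1
        simp only [Submodule.coe_smul, Matrix.transpose_smul, Matrix.smul_mul, Matrix.mul_smul,
          ← smul_add]
        rw [smul_comm])

theorem coe_symProd (X Y : lowerTri m) :
    (symProd m X Y : Matrix (Fin m) (Fin m) ℝ) =
      (1 / 2 : ℝ) • ((X : Matrix (Fin m) (Fin m) ℝ) * (Y : Matrix (Fin m) (Fin m) ℝ)ᵀ +
          (Y : Matrix (Fin m) (Fin m) ℝ) * (X : Matrix (Fin m) (Fin m) ℝ)ᵀ) := rfl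

theorem coe_symProd_self (L : lowerTri m) :
    (symProd m L L : Matrix (Fin m) (Fin m) ℝ) =
      (L : Matrix (Fin m) (Fin m) ℝ) * (L : Matrix (Fin m) (Fin m) ℝ)ᵀ := by
  rw [coe_symProd, ← two_smul ℝ, smul_smul]
  norm_num

/-- The differential of `L ↦ L Lᵀ`. -/
def symProdDeriv (L : lowerTri m) : NormCLM (lowerTri m) (symMat m) :=
  (symProd m).flip L + symProd m L

theorem coe_symProdDeriv (L X : lowerTri m) :
    (symProdDeriv L X : Matrix (Fin m) (Fin m) ℝ) =
      (L : Matrix (Fin m) (Fin m) ℝ) * (X : Matrix (Fin m) (Fin m) ℝ)ᵀ +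
          (X : Matrix (Fin m) (Fin m) ℝ) * (L : Matrix (Fin m) (Fin m) ℝ)ᵀ := by
  change (symProd m X L : Matrix (Fin m) (Fin m) ℝ) + symProd m L X = _
  rw [coe_symProd, coe_symProd, add_comm ((X : Matrix (Fin m) (Fin m) ℝ) * _), ← two_smul ℝ,
    smul_smul]
  norm_num

theorem halfLower_add_transpose {A : Matrix (Fin m) (Fin m) ℝ} (hA : A ∈ lowerTri m) :
    halfLower (Aᵀ + A) = A := by
  ext i j
  rcases lt_trichotomy i j with h | rfl | h
  · simp [halfLower, lowPart, diagPart, h.ne, h.not_gt, hA i j h]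
  · simp only [halfLower, lowPart, diagPart, Matrix.add_apply, Matrix.smul_apply, Matrix.of_apply,
      Matrix.diagonal_apply_eq, Matrix.transpose_apply, lt_irrefl, if_false, smul_eq_mul]
    ring
  · simp [halfLower, lowPart, diagPart, h.ne', h, hA j i h]

theorem halfLower_transpose_add {S : Matrix (Fin m) (Fin m) ℝ} (hS : S.IsSymm) :
    (halfLower S)ᵀ + halfLower S = S := by
  ext i j
  rcases lt_trichotomy i j with h | rfl | h
  · simp [halfLower, lowPart, diagPart, h.ne, h.not_gt, h, hS.apply i j]
  · simp only [halfLower, lowPart, diagPart, Matrix.add_apply, Matrix.smul_apply, Matrix.of_apply,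
      Matrix.diagonal_apply_eq, Matrix.transpose_apply, lt_irrefl, if_false, smul_eq_mul]
    ring
  · simp [halfLower, lowPart, diagPart, h.ne', h, h.not_gt]

/-- Conjugating `L Xᵀ + X Lᵀ` by `L⁻¹` gives `Aᵀ + A` with `A = L⁻¹ X` lower triangular, and
`halfLower` recovers `A` because the sum only doubles its diagonal. -/
theorem pullVec_symProdDeriv {L : lowerTri m} (hL : L ∈ choleskySpace m) (X : lowerTri m) :
    pullVec L (symProdDeriv L X : Matrix (Fin m) (Fin m) ℝ) = X := by
  have hd := det_ne_zero hL
  have hLow := mul_mem_lowerTri (inv_mem_lowerTri L.2 hd) X.2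
  ext1
  rw [coe_symProdDeriv]
  obtain ⟨A, hA⟩ := L
  obtain ⟨X, hX⟩ := X
  change A * halfLower (A⁻¹ * (A * Xᵀ + X * Aᵀ) * (A⁻¹)ᵀ) = X
  have hu : IsUnit A.det := hd.isUnit
  have h1 : A⁻¹ * (A * Xᵀ + X * Aᵀ) * (A⁻¹)ᵀ = (A⁻¹ * X)ᵀ + A⁻¹ * X := by
    rw [mul_add, add_mul, Matrix.nonsing_inv_mul_cancel_left _ _ hu, ← Matrix.transpose_mul,
      Matrix.mul_assoc A⁻¹, Matrix.mul_assoc X, ← Matrix.transpose_mul,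
      Matrix.nonsing_inv_mul _ hu, Matrix.transpose_one, Matrix.mul_one]
  rw [h1, halfLower_add_transpose hLow, Matrix.mul_nonsing_inv_cancel_left _ _ hu]

theorem symProdDeriv_pullVec {L : lowerTri m} (hL : L ∈ choleskySpace m) (W : symMat m) :
    symProdDeriv L (pullVec L (W : Matrix (Fin m) (Fin m) ℝ)) = W := by
  have hd := det_ne_zero hL
  ext1
  rw [coe_symProdDeriv]
  obtain ⟨A, hA⟩ := L
  obtain ⟨W, hW⟩ := W
  have hu : IsUnit A.det := hd.isUnit
  have hW' : Wᵀ = W := hW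
  set S := A⁻¹ * W * (A⁻¹)ᵀ with hS
  have hSs : S.IsSymm := by
    rw [Matrix.IsSymm, hS, Matrix.transpose_mul, Matrix.transpose_mul, hW',
      Matrix.transpose_transpose, Matrix.mul_assoc]
  change A * (A * halfLower S)ᵀ + A * halfLower S * Aᵀ = W
  rw [Matrix.transpose_mul, ← Matrix.mul_assoc, ← Matrix.add_mul, ← Matrix.mul_add,
    halfLower_transpose_add hSs, hS, Matrix.mul_assoc, Matrix.mul_assoc, Matrix.mul_assoc,
    ← Matrix.transpose_mul, Matrix.mul_nonsing_inv _ hu, Matrix.transpose_one, Matrix.mul_one,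
    Matrix.mul_nonsing_inv_cancel_left _ _ hu]

theorem symProd_self_mem_spd {L : lowerTri m} (hL : L ∈ choleskySpace m) :
    symProd m L L ∈ spd m := by
  change (symProd m L L : Matrix (Fin m) (Fin m) ℝ).PosDef
  rw [coe_symProd_self]
  have h : IsUnit (L : Matrix (Fin m) (Fin m) ℝ) :=
    (Matrix.isUnit_iff_isUnit_det _).2 (det_ne_zero hL).isUnit
  exact Matrix.PosDef.mul_conjTranspose_self _ (Matrix.vecMul_injective_of_isUnit h)

theorem symProd_cholesky {P : symMat m} (hP : P ∈ spd m) :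
    symProd m (cholesky P) (cholesky P) = P := by
  ext1
  rw [coe_symProd_self, (cholesky_spec hP).2]

theorem cholesky_symProd {L : lowerTri m} (hL : L ∈ choleskySpace m) :
    cholesky (symProd m L L) = L := by
  have h := cholesky_spec (symProd_self_mem_spd hL)
  exact cholesky_unique h.1 hL (by rw [h.2, coe_symProd_self])

theorem isFlatChart_logCholMetric :
    IsFlatChart (spd m) logCholMetric (fun P => mapDiag Real.log (cholesky P))
      (fun Y => symProd m (mapDiag Real.exp Y) (mapDiag Real.exp Y)) (frobForm m) :=
  isFlatChart_cholMetric.transfer (s := fun L => symProd m L L) (χ := cholesky)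
    (T := symProdDeriv) (inv := fun L W => pullVec L W) (contDiff_apply_self _)
    (fun _ hL => symProd_self_mem_spd hL) (fun _ hL => cholesky_symProd hL)
    (fun _ hP => (cholesky_spec hP).1) (fun _ hP => symProd_cholesky hP)
    (hasFDerivAt_apply_self _) (fun _ hL => pullVec_symProdDeriv hL)
    -- The final `rfl`: `logCholMetric` is by definition `cholMetric` evaluated on `pullVec`.
    (fun _ hL => symProdDeriv_pullVec hL) (fun _ _ _ _ => rfl)

theorem fderiv_logCholChart {P : symMat m} (hP : P ∈ spd m) (W : symMat m) :
    (fderiv ℝ (fun P => mapDiag Real.log (cholesky P)) P : NormCLM (symMat m) (lowerTri m)) W =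
      scaleDiag (fun i => ((cholesky P : Matrix (Fin m) (Fin m) ℝ) i i)⁻¹)
        (pullVec (cholesky P) W) := by
  refine (isFlatChart_cholMetric.fderiv_comp (s := fun L => symProd m L L) (χ := cholesky)
    (T := symProdDeriv) (inv := fun L W => pullVec L W) (V := spd m) (contDiff_apply_self _)
    (fun _ hL => cholesky_symProd hL)
    (fun _ hP => (cholesky_spec hP).1) (fun _ hP => symProd_cholesky hP)
    (hasFDerivAt_apply_self _) (fun _ hL => pullVec_symProdDeriv hL)
    (fun _ hL => symProdDeriv_pullVec hL) hP W).trans ?_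
  rw [(hasFDerivAt_mapDiag_log (cholesky_spec hP).1).fderiv]

theorem pullVec_eq_iff {K : lowerTri m} (hK : K ∈ choleskySpace m) (V : symMat m)
    {Y : Matrix (Fin m) (Fin m) ℝ} (hY : Y ∈ lowerTri m) :
    (pullVec K V : Matrix (Fin m) (Fin m) ℝ) = Y ↔
      (V : Matrix (Fin m) (Fin m) ℝ) = (K : Matrix (Fin m) (Fin m) ℝ) * Yᵀ +
        Y * (K : Matrix (Fin m) (Fin m) ℝ)ᵀ := by
  have h := coe_symProdDeriv K ⟨Y, hY⟩
  constructor
  · intro hp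
    have hp' : pullVec K V = ⟨Y, hY⟩ := Subtype.ext hp
    rw [← symProdDeriv_pullVec hK V, hp']
    exact h
  · intro hV
    rw [hV]
    exact congrArg Subtype.val ((congrArg (pullVec K) h).symm.trans
      (pullVec_symProdDeriv hK ⟨Y, hY⟩))

theorem transportFormula_mem (L K X : lowerTri m) :
    transportFormula (L : Matrix (Fin m) (Fin m) ℝ) K X ∈ lowerTri m := by
  have hlow : lowPart (X : Matrix (Fin m) (Fin m) ℝ) ∈ lowerTri m := fun i j hij => by
    simp [lowPart, hij.not_gt]
  have hdiag : ∀ A : Matrix (Fin m) (Fin m) ℝ, diagPart A ∈ lowerTri m := fun A i j hij =>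
    Matrix.diagonal_apply_ne _ hij.ne
  have hinv : (diagPart (L : Matrix (Fin m) (Fin m) ℝ))⁻¹ ∈ lowerTri m := fun i j hij => by
    rw [diagPart, Matrix.inv_diagonal, Matrix.diagonal_apply_ne _ hij.ne]
  exact Submodule.add_mem _ hlow (mul_mem_lowerTri (mul_mem_lowerTri (hdiag _) hinv) (hdiag _))

end

end LogCholesky

theorem mainTheorem5 (m : ℕ) :
    (IsRiemannianMetricOn (choleskySpace m) cholMetric ∧
      ∀ L ∈ choleskySpace m, ∀ K ∈ choleskySpace m,
        (∃ γ, IsGeodesic (choleskySpace m) cholMetric L K γ) ∧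
        ∀ γ, IsGeodesic (choleskySpace m) cholMetric L K γ →
          ∀ X Y : lowerTri m, Transports cholMetric γ X Y ↔
            (Y : Matrix (Fin m) (Fin m) ℝ) = transportFormula L K X) ∧
    (IsRiemannianMetricOn (spd m) logCholMetric ∧
      ∀ P ∈ spd m, ∀ Q ∈ spd m,
        (∃ γ, IsGeodesic (spd m) logCholMetric P Q γ) ∧
        ∀ γ, IsGeodesic (spd m) logCholMetric P Q γ →
          ∀ W V : symMat m, Transports logCholMetric γ W V ↔
            (V : Matrix (Fin m) (Fin m) ℝ) =
              (cholesky Q : Matrix (Fin m) (Fin m) ℝ) *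
                  (transportFormula (cholesky P) (cholesky Q) (pullVec (cholesky P) W))ᵀ +
                transportFormula (cholesky P) (cholesky Q) (pullVec (cholesky P) W) *
                  (cholesky Q : Matrix (Fin m) (Fin m) ℝ)ᵀ) := by
  refine ⟨⟨isFlatChart_cholMetric.isRiemannianMetricOn, fun L hL K hK =>
    ⟨isFlatChart_cholMetric.exists_isGeodesic hL hK, fun γ hγ X Y => ?_⟩⟩,
    isFlatChart_logCholMetric.isRiemannianMetricOn, fun P hP Q hQ =>
    ⟨isFlatChart_logCholMetric.exists_isGeodesic hP hQ, fun γ hγ W V => ?_⟩⟩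
  · rw [isFlatChart_cholMetric.transports_iff hγ.smooth hγ.mem, hγ.source, hγ.target,
      (hasFDerivAt_mapDiag_log hL).fderiv, (hasFDerivAt_mapDiag_log hK).fderiv,
      scaleDiag_eq_iff hL hK]
  -- In Cholesky coordinates this is the first case for the vectors `pullVec`; `pullVec_eq_iff` then
  -- returns to symmetric matrices through the differential of `L ↦ L Lᵀ`.
  · rw [isFlatChart_logCholMetric.transports_iff hγ.smooth hγ.mem, hγ.source, hγ.target,
      fderiv_logCholChart hP, fderiv_logCholChart hQ,
      scaleDiag_eq_iff (cholesky_spec hP).1 (cholesky_spec hQ).1,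
      pullVec_eq_iff (cholesky_spec hQ).1 V (transportFormula_mem _ _ _)]
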